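/- For $n\ge 1$ let $\mathcal T(n)$ be the set of rooted (non-planar) trees whose vertices are in bijection with $[n]=\{1,\dots,n\}$; edges are oriented towards the root, and the incoming vertices of a vertex $i$ are the vertices $k$ such that $(k,i)$ is an oriented edge. For $T\in\mathcal T(n)$, $S\in\mathcal T(m)$ and $1\le i\le n$ let $T\circ_i S\in\mathcal T(n+m-1)$ be the tree obtained by substituting $S$ for the vertex $i$ of $T$: the outgoing vertex of $i$ (if there is one) becomes the outgoing vertex of the root of $S$; an incoming vertex $k$ of $i$ is grafted on the vertex $m$ of $S$ if $k<i$ and on the vertex $1$ of $S$ if $k>i$; then $i-1$ is added to the labels of $S$, and $m-1$ is added to the labels of $T$ that are greater than $i$. With these compositions, and with the one-vertex tree as unit, the sets $\mathcal T(n)$ form a non-symmetric operad in the category of sets, denoted by $\mathcal T_{\mathrm{Max}}$, and for every field $\mathbf k$ the vector spaces $\mathbf k\mathcal T(n)$ form a non-symmetric operad over $\mathbf k$, its linearization $\mathbf k\mathcal T_{\mathrm{Max}}$. Call a tree with $n\ge 2$ vertices indecomposable if it is not of the form $T\circ_i S$ with $T$ and $S$ both having at least two vertices. **Theorem.** The non-symmetric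 operad $\mathcal T_{\mathrm{Max}}$ is free, both in sets and in vector spaces, on the indecomposable trees. Precisely: 1. The operad $\mathcal T_{\mathrm{Max}}$ is reduced (there is no operation of arity $0$, and the unit is the only one of arity $1$), and for every non-symmetric operad $Q$ in sets, every family of maps $\varphi_n$ from the set of indecomposable trees in $\mathcal T(n)$ to $Q(n)$ extends to a unique morphism of operads $\mathcal T_{\mathrm{Max}}\to Q$. 2. For every field $\mathbf k$, the operad $\mathbf k\mathcal T_{\mathrm{Max}}$ is reduced (it vanishes in arity $0$, and is $\mathbf k$, spanned by the unit, in arity $1$), and for every non-symmetric operad $Q$ in $\mathbf k$-vector spaces, every family of linear maps $\varphi_n$ from the span of the indecomposable trees in $\mathbf k\mathcal T(n)$ to $Q(n)$ extends to a unique morphism of operads $\mathbf k\mathcal T_{\mathrm{Max}}\to Q$. -/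

import Mathlib

/-! ### Non-symmetric operads in sets -/

universe u v w

/-- A non-symmetric operad in the category of sets, given by its partial compositions.
`Op n` is the set of operations of arity `n`. Inputs are numbered from `0`, so `i : Fin n` stands
for the input number `i + 1`, and `comp h i a b` is the partial composition usually written
`a ∘_{i+1} b`. The arity `l = n + m - 1` of the result is recorded by the equation
`h : l + 1 = n + m`, so that no transport between arities is needed. -/
structure NSOperad where
  Op : ℕ → Type u
  one : Op 1
  comp : ∀ {n m l : ℕ}, l + 1 = n + m → Fin n → Op n → Op m → Op l
  /-- `(a ∘_i b) ∘_{i+j-1} c = a ∘_i (b ∘_j c)` (positions counted from `1`). -/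
  comp_assoc : ∀ {n m p q r s : ℕ} (h₁ : q + 1 = n + m) (h₂ : r + 1 = q + p)
    (h₃ : s + 1 = m + p) (h₄ : r + 1 = n + s) (i : Fin n) (j : Fin m)
    (a : Op n) (b : Op m) (c : Op p),
    comp h₂ ⟨i + j, by omega⟩ (comp h₁ i a b) c = comp h₄ i a (comp h₃ j b c)
  /-- `(a ∘_i b) ∘_j c = (a ∘_j c) ∘_{i+p-1} b` for `j < i`, where `p` is the arity of `c`. -/
  comp_comm : ∀ {n m p q r s : ℕ} (h₁ : q + 1 = n + m) (h₂ : r + 1 = q + p)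
    (h₃ : s + 1 = n + p) (h₄ : r + 1 = s + m) (i j : Fin n) (hji : (j : ℕ) < i)
    (a : Op n) (b : Op m) (c : Op p),
    comp h₂ ⟨j, by omega⟩ (comp h₁ i a b) c
      = comp h₄ ⟨i + p - 1, by omega⟩ (comp h₃ j a c) b
  one_comp : ∀ {n : ℕ} (h : n + 1 = 1 + n) (a : Op n), comp h 0 one a = a
  comp_one : ∀ {n : ℕ} (h : n + 1 = n + 1) (i : Fin n) (a : Op n), comp h i a one = a

namespace NSOperad

/-- Morphisms of non-symmetric operads. -/
structure Hom (P : NSOperad.{u}) (Q : NSOperad.{v}) where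
  toFun : ∀ n, P.Op n → Q.Op n
  map_one : toFun 1 P.one = Q.one
  map_comp : ∀ {n m l : ℕ} (h : l + 1 = n + m) (i : Fin n) (a : P.Op n) (b : P.Op m),
    toFun l (P.comp h i a b) = Q.comp h i (toFun n a) (toFun m b)

/-- No operation of arity `0`, and the unit is the only operation of arity `1`. -/
def IsReduced (P : NSOperad.{u}) : Prop :=
  IsEmpty (P.Op 0) ∧ ∀ x : P.Op 1, x = P.one

/-- `x` is the result of a non-trivial composition, that is, of a composition of two operations
both of arity at least `2`. -/
def IsDecomposable (P : NSOperad.{u}) {l : ℕ} (x : P.Op l) : Prop :=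
  ∃ (n m : ℕ) (h : l + 1 = n + m) (i : Fin n) (a : P.Op n) (b : P.Op m),
    2 ≤ n ∧ 2 ≤ m ∧ x = P.comp h i a b

/-- The operations of arity `n ≥ 2` that are not the result of a non-trivial composition. -/
def indecomposables (P : NSOperad.{u}) (n : ℕ) : Set (P.Op n) :=
  {x | 2 ≤ n ∧ ¬ P.IsDecomposable x}

/-- `P` is the free non-symmetric operad on the collection `E` of its operations: every arity
preserving map from `E` to a non-symmetric operad `Q` extends to exactly one morphism of operads
from `P` to `Q`. -/
def IsFreeOn (P : NSOperad.{u}) (E : ∀ n, Set (P.Op n)) : Prop :=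
  ∀ (Q : NSOperad.{v}) (φ : ∀ n, E n → Q.Op n),
    ∃! F : Hom P Q, ∀ (n : ℕ) (x : E n), F.toFun n x = φ n x

end NSOperad

/-! ### Non-symmetric operads in vector spaces -/

/-- A non-symmetric operad in vector spaces over `k`, with the same conventions as for
`NSOperad`; the partial compositions are bilinear. -/
structure LinNSOperad (k : Type u) [Field k] where
  Op : ℕ → Type v
  [addCommGroup : ∀ n, AddCommGroup (Op n)]
  [module : ∀ n, Module k (Op n)]
  one : Op 1
  comp : ∀ {n m l : ℕ}, l + 1 = n + m → Fin n → (Op n →ₗ[k] Op m →ₗ[k] Op l)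
  comp_assoc : ∀ {n m p q r s : ℕ} (h₁ : q + 1 = n + m) (h₂ : r + 1 = q + p)
    (h₃ : s + 1 = m + p) (h₄ : r + 1 = n + s) (i : Fin n) (j : Fin m)
    (a : Op n) (b : Op m) (c : Op p),
    comp h₂ ⟨i + j, by omega⟩ (comp h₁ i a b) c = comp h₄ i a (comp h₃ j b c)
  comp_comm : ∀ {n m p q r s : ℕ} (h₁ : q + 1 = n + m) (h₂ : r + 1 = q + p)
    (h₃ : s + 1 = n + p) (h₄ : r + 1 = s + m) (i j : Fin n) (hji : (j : ℕ) < i)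
    (a : Op n) (b : Op m) (c : Op p),
    comp h₂ ⟨j, by omega⟩ (comp h₁ i a b) c
      = comp h₄ ⟨i + p - 1, by omega⟩ (comp h₃ j a c) b
  one_comp : ∀ {n : ℕ} (h : n + 1 = 1 + n) (a : Op n), comp h 0 one a = a
  comp_one : ∀ {n : ℕ} (h : n + 1 = n + 1) (i : Fin n) (a : Op n), comp h i a one = a

attribute [instance] LinNSOperad.addCommGroup LinNSOperad.module

namespace LinNSOperad

/-- Morphisms of linear non-symmetric operads. -/
structure Hom {k : Type u} [Field k] (P : LinNSOperad.{u, v} k) (Q : LinNSOperad.{u, w} k) where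
  toFun : ∀ n, P.Op n →ₗ[k] Q.Op n
  map_one : toFun 1 P.one = Q.one
  map_comp : ∀ {n m l : ℕ} (h : l + 1 = n + m) (i : Fin n) (a : P.Op n) (b : P.Op m),
    toFun l (P.comp h i a b) = Q.comp h i (toFun n a) (toFun m b)

/-- There is nothing in arity `0`, and arity `1` is the ground field with basis the unit. -/
def IsReduced {k : Type u} [Field k] (P : LinNSOperad.{u, v} k) : Prop :=
  Subsingleton (P.Op 0) ∧ Function.Bijective (fun c : k => c • P.one)

/-- `P` is the free linear non-symmetric operad on the collection `V` of subspaces: every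
arity preserving collection of linear maps from `V` to a linear non-symmetric operad `Q` extends
to exactly one morphism of operads from `P` to `Q`. -/
def IsFreeOn {k : Type u} [Field k] (P : LinNSOperad.{u, v} k)
    (V : ∀ n, Submodule k (P.Op n)) : Prop :=
  ∀ (Q : LinNSOperad.{u, w} k) (φ : ∀ n, V n →ₗ[k] Q.Op n),
    ∃! F : Hom P Q, ∀ (n : ℕ) (x : V n), F.toFun n x = φ n x

end LinNSOperad

/-- The bilinear extension of a partial composition of `P`. -/
noncomputable def NSOperad.linComp (k : Type u) [Field k] (P : NSOperad.{v}) {n m l : ℕ}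
    (h : l + 1 = n + m) (i : Fin n) :
    (P.Op n →₀ k) →ₗ[k] (P.Op m →₀ k) →ₗ[k] (P.Op l →₀ k) :=
  Finsupp.linearCombination k (fun a => Finsupp.lmapDomain k k (P.comp h i a))

theorem NSOperad.linComp_single {k : Type u} [Field k] (P : NSOperad.{v}) {n m l : ℕ}
    (h : l + 1 = n + m) (i : Fin n) (a : P.Op n) (b : P.Op m) (x y : k) :
    P.linComp k h i (Finsupp.single a x) (Finsupp.single b y)
      = Finsupp.single (P.comp h i a b) (x * y) := by
  rw [NSOperad.linComp, Finsupp.linearCombination_single, LinearMap.smul_apply,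
    Finsupp.lmapDomain_apply, Finsupp.mapDomain_single, Finsupp.smul_single, smul_eq_mul]

/-- The linearization of a set operad: `n`-ary operations are the formal `k`-linear combinations
of `n`-ary operations of `P`, and compositions are extended bilinearly. -/
noncomputable def NSOperad.linearize (k : Type u) [Field k] (P : NSOperad.{v}) :
    LinNSOperad k where
  Op n := P.Op n →₀ k
  one := Finsupp.single P.one 1
  comp h i := P.linComp k h i
  comp_assoc h₁ h₂ h₃ h₄ i j a b c := by
    induction a using Finsupp.induction_linear with
    | zero => simp
    | add a a' ha ha' => simp only [map_add, LinearMap.add_apply, ha, ha']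
    | single a x =>
    induction b using Finsupp.induction_linear with
    | zero => simp
    | add b b' hb hb' => simp only [map_add, LinearMap.add_apply, hb, hb']
    | single b y =>
    induction c using Finsupp.induction_linear with
    | zero => simp
    | add c c' hc hc' => simp only [map_add, hc, hc']
    | single c z => simp only [P.linComp_single, P.comp_assoc h₁ h₂ h₃ h₄, mul_assoc]
  comp_comm h₁ h₂ h₃ h₄ i j hji a b c := by
    induction a using Finsupp.induction_linear with
    | zero => simp
    | add a a' ha ha' => simp only [map_add, LinearMap.add_apply, ha, ha']
    | single a x =>
    induction b using Finsupp.induction_linear with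
    | zero => simp
    | add b b' hb hb' => simp only [map_add, LinearMap.add_apply, hb, hb']
    | single b y =>
    induction c using Finsupp.induction_linear with
    | zero => simp
    | add c c' hc hc' => simp only [map_add, LinearMap.add_apply, hc, hc']
    | single c z =>
      simp only [P.linComp_single, P.comp_comm h₁ h₂ h₃ h₄ i j hji, mul_assoc, mul_comm y z]
  one_comp h a := by
    induction a using Finsupp.induction_linear with
    | zero => simp
    | add a a' ha ha' => simp only [map_add, ha, ha']
    | single a x => simp only [P.linComp_single, P.one_comp h, one_mul]
  comp_one h i a := by
    induction a using Finsupp.induction_linear with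
    | zero => simp
    | add a a' ha ha' => simp only [map_add, LinearMap.add_apply, ha, ha']
    | single a x => simp only [P.linComp_single, P.comp_one h, mul_one]

/-! ### Labelled rooted trees -/

/-- An `n`-labelled rooted tree. The vertices are the elements of `Fin n`; the vertex `a`
carries the label `a + 1`. Edges are oriented towards the root: `parent a = some b` says that
`b` is the outgoing vertex of `a`, equivalently that `a` is an incoming vertex of `b`. The root is
a vertex without outgoing vertex, and every vertex is joined to the root by an oriented path. -/
structure LabelledTree (n : ℕ) where
  root : Fin n
  parent : Fin n → Option (Fin n)
  parent_root : parent root = none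
  path_root : ∀ a, Relation.ReflTransGen (fun x y => parent x = some y) a root

namespace LabelledTree

theorem ext_parent {n : ℕ} {T S : LabelledTree n} (h : ∀ a, T.parent a = S.parent a) : T = S := by
  have hp : T.parent = S.parent := funext h
  have hr : T.root = S.root := by
    rcases Relation.ReflTransGen.cases_head (S.path_root T.root) with h' | ⟨c, hc, -⟩
    · exact h'
    · rw [← h, T.parent_root] at hc
      simp at hc
  cases T
  cases S
  simp only at hp hr
  subst hp hr
  rfl

/-- The new name in `T ∘_i S` of a vertex `a ≠ i` of `T`, where `S` has `m` vertices. -/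
def embT {n m l : ℕ} (h : l + 1 = n + m) (hm : 0 < m) (i a : Fin n) : Fin l :=
  ⟨if (a : ℕ) < i then a else a + m - 1, by split_ifs <;> omega⟩

/-- The new name in `T ∘_i S` of a vertex `b` of `S`. -/
def embS {n m l : ℕ} (h : l + 1 = n + m) (i : Fin n) (b : Fin m) : Fin l :=
  ⟨b + i, by omega⟩

/-- The vertex of `T` (different from `i`) or of `S` whose new name in `T ∘_i S` is `x`. -/
def origin {n m l : ℕ} (h : l + 1 = n + m) (i : Fin n) (x : Fin l) : Fin n ⊕ Fin m :=
  if h₁ : (x : ℕ) < i then .inl ⟨x, by omega⟩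
  else if h₂ : (x : ℕ) < i + m then .inr ⟨x - i, by omega⟩
  else .inl ⟨x + 1 - m, by omega⟩

theorem origin_embT {n m l : ℕ} (h : l + 1 = n + m) (hm : 0 < m) (i a : Fin n) (ha : a ≠ i) :
    origin h i (embT h hm i a) = .inl a := by
  have ha' : (a : ℕ) ≠ i := fun e => ha (Fin.ext e)
  unfold origin embT
  by_cases h₁ : (a : ℕ) < i
  · simp [h₁]
  · have h₂ : ¬ ((a : ℕ) + m - 1 < i) := by omega
    have h₃ : ¬ ((a : ℕ) + m - 1 < i + m) := by omega
    simp only [h₁, h₂, h₃, if_false, dite_false]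
    congr 1
    apply Fin.ext
    simp only
    omega

theorem origin_embS {n m l : ℕ} (h : l + 1 = n + m) (i : Fin n) (b : Fin m) :
    origin h i (embS h i b) = .inr b := by
  unfold origin embS
  have h₁ : ¬ ((b : ℕ) + i < i) := by omega
  have h₂ : (b : ℕ) + i < i + m := by omega
  simp [h₁, h₂]

theorem eq_embT_or_eq_embS {n m l : ℕ} (h : l + 1 = n + m) (hm : 0 < m) (i : Fin n) (x : Fin l) :
    (∃ a, a ≠ i ∧ x = embT h hm i a) ∨ ∃ b, x = embS h i b := by
  by_cases h₁ : (x : ℕ) < i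
  · refine .inl ⟨⟨x, by omega⟩, ?_, ?_⟩
    · intro e
      have := congrArg Fin.val e
      simp only at this
      omega
    · apply Fin.ext
      simp [embT, h₁]
  · by_cases h₂ : (x : ℕ) < i + m
    · refine .inr ⟨⟨x - i, by omega⟩, ?_⟩
      apply Fin.ext
      simp only [embS]
      omega
    · refine .inl ⟨⟨x + 1 - m, by omega⟩, ?_, ?_⟩
      · intro e
        have := congrArg Fin.val e
        simp only at this
        omega
      · apply Fin.ext
        simp only [embT]
        split_ifs <;> omega

/-- The outgoing vertices in `T ∘_i^f S`. A vertex `a ≠ i` of `T` keeps its outgoing vertex, except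
that it is grafted on the vertex `f a` of `S` if its outgoing vertex was `i`. A vertex of `S`
other than the root of `S` keeps its outgoing vertex, and the outgoing vertex of the root of `S`
becomes the one that `i` had in `T`, if there is one. -/
def graftParent {n m l : ℕ} (h : l + 1 = n + m) (hm : 0 < m) (i : Fin n)
    (T : LabelledTree n) (S : LabelledTree m) (f : Fin n → Fin m) (x : Fin l) : Option (Fin l) :=
  match origin h i x with
  | .inl a => (T.parent a).map fun b => if b = i then embS h i (f a) else embT h hm i b
  | .inr a =>
    match S.parent a with
    | some b => some (embS h i b)
    | none => (T.parent i).map (embT h hm i)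

section

variable {n m l : ℕ} (h : l + 1 = n + m) (hm : 0 < m) (i : Fin n)
  (T : LabelledTree n) (S : LabelledTree m) (f : Fin n → Fin m)

theorem graftParent_embT (a : Fin n) (ha : a ≠ i) :
    graftParent h hm i T S f (embT h hm i a)
      = (T.parent a).map fun b => if b = i then embS h i (f a) else embT h hm i b := by
  rw [graftParent, origin_embT h hm i a ha]

theorem graftParent_embS (a : Fin m) :
    graftParent h hm i T S f (embS h i a)
      = match S.parent a with
        | some b => some (embS h i b)
        | none => (T.parent i).map (embT h hm i) := by
  rw [graftParent, origin_embS h i a]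

theorem parent_ne_self (a : Fin n) : T.parent a ≠ some a := by
  intro e
  have key : ∀ x, Relation.ReflTransGen (fun x y => T.parent x = some y) a x → x = a := by
    intro x hx
    induction hx with
    | refl => rfl
    | tail _ hs ih =>
      subst ih
      rw [e] at hs
      exact (Option.some.inj hs).symm
  have hr := key _ (T.path_root a)
  rw [← hr, T.parent_root] at e
  simp at e

theorem graft_path_S (a : Fin m) :
    Relation.ReflTransGen (fun x y => graftParent h hm i T S f x = some y)
      (embS h i a) (embS h i S.root) := by
  refine Relation.ReflTransGen.lift (p := fun x y => graftParent h hm i T S f x = some y)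
    (embS h i) ?_ _ _ (S.path_root a)
  intro x y hxy
  change graftParent h hm i T S f (embS h i x) = some (embS h i y)
  rw [graftParent_embS, hxy]

theorem graft_path_T (a : Fin n) :
    Relation.ReflTransGen (fun x y => graftParent h hm i T S f x = some y)
      (if a = i then embS h i S.root else embT h hm i a)
      (if T.root = i then embS h i S.root else embT h hm i T.root) := by
  induction T.path_root a using Relation.ReflTransGen.head_induction_on with
  | refl => exact .refl
  | @head a b hab _ ih =>
    by_cases ha : a = i
    · subst ha
      have hb : b ≠ a := fun e => parent_ne_self T a (e ▸ hab)
      rw [if_neg hb] at ih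
      rw [if_pos rfl]
      refine .head ?_ ih
      rw [graftParent_embS, S.parent_root]
      simp [hab]
    · rw [if_neg ha]
      by_cases hb : b = i
      · rw [if_pos hb] at ih
        refine .head (b := embS h i (f a)) ?_ ((graft_path_S h hm i T S f (f a)).trans ih)
        rw [graftParent_embT h hm i T S f a ha, hab]
        simp [hb]
      · rw [if_neg hb] at ih
        refine .head ?_ ih
        rw [graftParent_embT h hm i T S f a ha, hab]
        simp [hb]

end

/-- The tree `T ∘_i^f S` obtained by substituting the tree `S` for the vertex `i` of `T` and
grafting every incoming vertex `a` of `i` on the vertex `f a` of `S`. Only the values of `f` at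
the incoming vertices of `i` matter. -/
def graft {n m l : ℕ} (h : l + 1 = n + m) (i : Fin n)
    (T : LabelledTree n) (S : LabelledTree m) (f : Fin n → Fin m) : LabelledTree l where
  root := if T.root = i then embS h i S.root else embT h S.root.pos i T.root
  parent := graftParent h S.root.pos i T S f
  parent_root := by
    by_cases hr : T.root = i
    · rw [if_pos hr, graftParent_embS, S.parent_root, ← hr, T.parent_root]
      rfl
    · rw [if_neg hr, graftParent_embT _ _ _ _ _ _ _ hr, T.parent_root]
      rfl
  path_root x := by
    rcases eq_embT_or_eq_embS h S.root.pos i x with ⟨a, ha, rfl⟩ | ⟨b, rfl⟩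
    · have := graft_path_T h S.root.pos i T S f a
      rwa [if_neg ha] at this
    · have := graft_path_T h S.root.pos i T S f i
      rw [if_pos rfl] at this
      exact (graft_path_S h S.root.pos i T S f b).trans this

/-- The map `f_Max`: vertices with a label smaller than that of `i` are sent to the vertex of `S`
with the largest label, the other ones to the vertex of `S` with the smallest label. -/
def fMax {n m : ℕ} (hm : 0 < m) (i a : Fin n) : Fin m :=
  if a < i then ⟨m - 1, by omega⟩ else ⟨0, hm⟩

/-- The composition `T ∘_i S` of `T_Max`. -/
def compMax {n m l : ℕ} (h : l + 1 = n + m) (i : Fin n)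
    (T : LabelledTree n) (S : LabelledTree m) : LabelledTree l :=
  graft h i T S (fMax S.root.pos i)

/-- The tree with one vertex. -/
def single : LabelledTree 1 where
  root := 0
  parent _ := none
  parent_root := rfl
  path_root a := by
    rw [Subsingleton.elim a 0]

theorem compMax_parent_T {n m l : ℕ} (h : l + 1 = n + m) (hm : 0 < m) (i : Fin n)
    (T : LabelledTree n) (S : LabelledTree m) (a : Fin n) (ha : a ≠ i) :
    (compMax h i T S).parent (embT h hm i a) = (T.parent a).map fun b =>
      if b = i then embS h i (fMax hm i a) else embT h hm i b :=
  graftParent_embT h _ i T S _ a ha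

theorem compMax_parent_S {n m l : ℕ} (h : l + 1 = n + m) (hm : 0 < m) (i : Fin n)
    (T : LabelledTree n) (S : LabelledTree m) (a : Fin m) :
    (compMax h i T S).parent (embS h i a) = match S.parent a with
      | some b => some (embS h i b)
      | none => (T.parent i).map (embT h hm i) :=
  graftParent_embS h _ i T S _ a

theorem compMax_assoc {n m p q r s : ℕ} (h₁ : q + 1 = n + m) (h₂ : r + 1 = q + p)
    (h₃ : s + 1 = m + p) (h₄ : r + 1 = n + s) (i : Fin n) (j : Fin m)
    (T : LabelledTree n) (S : LabelledTree m) (U : LabelledTree p) :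
    compMax h₂ ⟨i + j, by omega⟩ (compMax h₁ i T S) U
      = compMax h₄ i T (compMax h₃ j S U) := by
  have hm : 0 < m := S.root.pos
  have hp : 0 < p := U.root.pos
  have hs : 0 < s := by omega
  have hij : (i + j : ℕ) < q := by omega
  have eij : (⟨i + j, hij⟩ : Fin q) = embS h₁ i j := Fin.ext (Nat.add_comm _ _)
  apply ext_parent
  intro x
  rcases eq_embT_or_eq_embS h₂ hp ⟨i + j, hij⟩ x with ⟨y, hy, rfl⟩ | ⟨c, rfl⟩
  · rw [compMax_parent_T h₂ hp _ _ _ y hy]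
    rcases eq_embT_or_eq_embS h₁ hm i y with ⟨a, ha, rfl⟩ | ⟨b, rfl⟩
    · have ha' : (a : ℕ) ≠ i := fun e => ha (Fin.ext e)
      have e : embT h₂ hp ⟨i + j, hij⟩ (embT h₁ hm i a) = embT h₄ hs i a := by
        apply Fin.ext
        simp only [embT]
        split_ifs <;> omega
      rw [e, compMax_parent_T h₁ hm _ _ _ a ha, compMax_parent_T h₄ hs _ _ _ a ha]
      rcases T.parent a with _ | w
      · rfl
      · simp only [Option.map_some, Option.some.injEq]
        apply Fin.ext
        simp only [embT, embS, fMax, Fin.ext_iff, Fin.lt_def]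
        grind
    · have hb' : (b : ℕ) ≠ j := fun e => hy (Fin.ext (by simp only [embS]; omega))
      have hb : b ≠ j := fun e => hb' (congrArg Fin.val e)
      have e : embT h₂ hp ⟨i + j, hij⟩ (embS h₁ i b) = embS h₄ i (embT h₃ hp j b) := by
        apply Fin.ext
        simp only [embT, embS]
        grind
      rw [e, compMax_parent_S h₁ hm, compMax_parent_S h₄ hs, compMax_parent_T h₃ hp _ _ _ b hb]
      rcases S.parent b with _ | w
      · rcases hT : T.parent i with _ | v
        · rfl
        · have hv : v ≠ i := fun e => parent_ne_self T i (e ▸ hT)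
          have hv' : (v : ℕ) ≠ i := fun e => hv (Fin.ext e)
          simp only [Option.map_some, Option.map_none, Option.some.injEq]
          apply Fin.ext
          simp only [embT, embS, fMax, Fin.ext_iff, Fin.lt_def]
          grind
      · simp only [Option.map_some, Option.some.injEq]
        apply Fin.ext
        simp only [embT, embS, fMax, Fin.ext_iff, Fin.lt_def]
        grind
  · have e : embS h₂ ⟨i + j, hij⟩ c = embS h₄ i (embS h₃ j c) := by
      apply Fin.ext
      simp only [embS]
      omega
    rw [e, compMax_parent_S h₄ hs, compMax_parent_S h₃ hp, ← e, compMax_parent_S h₂ hp, eij,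
      compMax_parent_S h₁ hm]
    rcases U.parent c with _ | w
    · rcases hS : S.parent j with _ | v
      · rcases hT : T.parent i with _ | v
        · rfl
        · have hv' : (v : ℕ) ≠ i := fun e => parent_ne_self T i (Fin.ext e ▸ hT)
          simp only [Option.map_some, Option.map_none, Option.some.injEq]
          apply Fin.ext
          simp only [embT, embS]
          grind
      · have hv' : (v : ℕ) ≠ j := fun e => parent_ne_self S j (Fin.ext e ▸ hS)
        simp only [Option.map_some, Option.some.injEq]
        apply Fin.ext
        simp only [embT, embS]
        grind
    · simp only [Option.some.injEq]
      apply Fin.ext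
      simp only [embS]
      omega

theorem compMax_comm {n m p q r s : ℕ} (h₁ : q + 1 = n + m) (h₂ : r + 1 = q + p)
    (h₃ : s + 1 = n + p) (h₄ : r + 1 = s + m) (i j : Fin n) (hji : (j : ℕ) < i)
    (T : LabelledTree n) (S : LabelledTree m) (U : LabelledTree p) :
    compMax h₂ ⟨j, by omega⟩ (compMax h₁ i T S) U
      = compMax h₄ ⟨i + p - 1, by omega⟩ (compMax h₃ j T U) S := by
  have hm : 0 < m := S.root.pos
  have hp : 0 < p := U.root.pos
  have hjq : (j : ℕ) < q := by omega
  have his : (i + p - 1 : ℕ) < s := by omega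
  have ej : (⟨j, hjq⟩ : Fin q) = embT h₁ hm i j := Fin.ext (by simp [embT, hji])
  have ei : (⟨i + p - 1, his⟩ : Fin s) = embT h₃ hp j i :=
    Fin.ext (by simp only [embT]; split_ifs <;> omega)
  have hij' : i ≠ j := fun e => by simp [e] at hji
  apply ext_parent
  intro x
  rcases eq_embT_or_eq_embS h₂ hp ⟨j, hjq⟩ x with ⟨y, hy, rfl⟩ | ⟨c, rfl⟩
  · rw [compMax_parent_T h₂ hp _ _ _ y hy]
    rcases eq_embT_or_eq_embS h₁ hm i y with ⟨a, ha, rfl⟩ | ⟨b, rfl⟩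
    · have ha' : (a : ℕ) ≠ i := fun e => ha (Fin.ext e)
      have haj' : (a : ℕ) ≠ j := fun e => hy (by rw [ej, Fin.ext e])
      have haj : a ≠ j := fun e => haj' (congrArg Fin.val e)
      have e : embT h₂ hp ⟨j, hjq⟩ (embT h₁ hm i a)
          = embT h₄ hm ⟨i + p - 1, his⟩ (embT h₃ hp j a) := by
        apply Fin.ext
        simp only [embT]
        split_ifs <;> omega
      have hne : embT h₃ hp j a ≠ ⟨i + p - 1, his⟩ := by
        intro e
        have := congrArg Fin.val e
        simp only [embT] at this
        split_ifs at this <;> omega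
      rw [e, compMax_parent_T h₁ hm _ _ _ a ha, compMax_parent_T h₄ hm _ _ _ _ hne,
        compMax_parent_T h₃ hp _ _ _ a haj]
      rcases T.parent a with _ | w
      · rfl
      · simp only [Option.map_some, Option.some.injEq]
        apply Fin.ext
        simp only [embT, embS, fMax, Fin.ext_iff, Fin.lt_def]
        grind
    · have e : embT h₂ hp ⟨j, hjq⟩ (embS h₁ i b) = embS h₄ ⟨i + p - 1, his⟩ b := by
        apply Fin.ext
        simp only [embT, embS]
        grind
      rw [e, compMax_parent_S h₁ hm, compMax_parent_S h₄ hm, ei,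
        compMax_parent_T h₃ hp _ _ _ i hij']
      rcases S.parent b with _ | w
      · rcases hT : T.parent i with _ | v
        · rfl
        · have hv' : (v : ℕ) ≠ i := fun e => parent_ne_self T i (Fin.ext e ▸ hT)
          simp only [Option.map_some, Option.some.injEq]
          apply Fin.ext
          simp only [embT, embS, fMax, Fin.ext_iff, Fin.lt_def]
          grind
      · simp only [Option.map_some, Option.some.injEq]
        apply Fin.ext
        simp only [embT, embS, fMax, Fin.ext_iff, Fin.lt_def]
        grind
  · have e : embS h₂ ⟨j, hjq⟩ c = embT h₄ hm ⟨i + p - 1, his⟩ (embS h₃ j c) := by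
      apply Fin.ext
      simp only [embT, embS]
      grind
    have hne : embS h₃ j c ≠ ⟨i + p - 1, his⟩ := by
      intro e
      have := congrArg Fin.val e
      simp only [embS] at this
      omega
    rw [compMax_parent_S h₂ hp, e, compMax_parent_T h₄ hm _ _ _ _ hne, compMax_parent_S h₃ hp, ej,
      compMax_parent_T h₁ hm _ _ _ j (Ne.symm hij')]
    rcases U.parent c with _ | w
    · rcases hT : T.parent j with _ | v
      · rfl
      · have hv' : (v : ℕ) ≠ j := fun e => parent_ne_self T j (Fin.ext e ▸ hT)
        simp only [Option.map_some, Option.some.injEq]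
        apply Fin.ext
        simp only [embT, embS, fMax, Fin.ext_iff, Fin.lt_def]
        grind
    · simp only [Option.map_some, Option.some.injEq]
      apply Fin.ext
      simp only [embT, embS, fMax, Fin.ext_iff, Fin.lt_def]
      grind

theorem single_compMax {n : ℕ} (h : n + 1 = 1 + n) (S : LabelledTree n) :
    compMax h 0 single S = S := by
  apply ext_parent
  intro x
  have e : embS h 0 x = x := Fin.ext (by simp [embS])
  have key := compMax_parent_S h x.pos 0 single S x
  rw [e] at key
  rw [key]
  rcases S.parent x with _ | w
  · rfl
  · exact congrArg some (Fin.ext (by simp [embS]))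

theorem compMax_single {n : ℕ} (h : n + 1 = n + 1) (i : Fin n) (T : LabelledTree n) :
    compMax h i T single = T := by
  have e : ∀ a, embT h Nat.one_pos i a = a := fun a => Fin.ext (by simp [embT])
  have e' : ∀ b, embS h i b = i := fun b => Fin.ext (by simp [embS])
  apply ext_parent
  intro x
  by_cases hx : x = i
  · subst hx
    have key := compMax_parent_S h Nat.one_pos x T single 0
    rw [e'] at key
    rw [key]
    change (T.parent x).map _ = _
    rcases T.parent x with _ | w
    · rfl
    · exact congrArg some (e w)
  · have key := compMax_parent_T h Nat.one_pos i T single x hx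
    rw [e] at key
    rw [key]
    rcases T.parent x with _ | w
    · rfl
    · simp only [Option.map_some, Option.some.injEq, e, e']
      split_ifs with hw
      · exact hw.symm
      · rfl

end LabelledTree

/-- The non-symmetric set operad `T_Max` of labelled rooted trees. -/
def TMax : NSOperad.{0} where
  Op := LabelledTree
  one := LabelledTree.single
  comp := LabelledTree.compMax
  comp_assoc := LabelledTree.compMax_assoc
  comp_comm := LabelledTree.compMax_comm
  one_comp := LabelledTree.single_compMax
  comp_one := LabelledTree.compMax_single

/-! Freeness is a confluence statement. A map on indecomposables must be extended by choosing a
decomposition `x = a ∘_i b`, applying the map recursively to both factors and composing in `Q`; only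
independence of the choice is at stake. In a reduced operad it is enough that any two decompositions
of `x` are related by a single instance of one of the operad axioms: one inner factor sits inside
the other (sequential axiom), or they fill different inputs of a common operation (parallel axiom).

For `TMax`, an inner factor of size `m` inserted at `i` occupies an interval of `m` consecutive
labels, and the intervals that arise are those satisfying `IsModule`: this is necessary by
`isModule_compMax` and sufficient by `IsModule.exists_eq_compMax`. By `compMax_injective` the
interval determines both factors. Two intervals are disjoint, comparable or properly overlapping.
The Max grafting rule excludes the last case (`IsModule.not_overlap`): a vertex beside a module can
only be attached to its far end when smaller and to its near end in the other direction (largest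
vertex from the left, smallest from the right), which would make some nonempty set of vertices
closed under taking parents. In the other two cases, modules of a composite descend to a factor, and
this produces the common operation.

The linear statement follows because morphisms out of the linearization are the same as set
morphisms into the underlying set operad of the target. -/

namespace NSOperad

/-! ### Decompositions and their compatibility -/

/-- A presentation of `x` as a composition of two operations of arity at least `2`. -/
structure Decomposition (P : NSOperad.{u}) {l : ℕ} (x : P.Op l) where
  n : ℕ
  m : ℕ
  h : l + 1 = n + m
  i : Fin n
  a : P.Op n
  b : P.Op m
  two_le_n : 2 ≤ n
  two_le_m : 2 ≤ m
  eq_comp : x = P.comp h i a b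

theorem IsDecomposable.nonempty_decomposition {P : NSOperad.{u}} {l : ℕ} {x : P.Op l}
    (hx : P.IsDecomposable x) : Nonempty (P.Decomposition x) := by
  obtain ⟨n, m, h, i, a, b, hn, hm, e⟩ := hx
  exact ⟨⟨n, m, h, i, a, b, hn, hm, e⟩⟩

namespace Decomposition

variable {P : NSOperad.{u}} {l : ℕ} {x : P.Op l}

theorem isDecomposable (d : P.Decomposition x) : P.IsDecomposable x :=
  ⟨d.n, d.m, d.h, d.i, d.a, d.b, d.two_le_n, d.two_le_m, d.eq_comp⟩

theorem n_lt (d : P.Decomposition x) : d.n < l := by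
  have := d.h
  have := d.two_le_m
  omega

theorem m_lt (d : P.Decomposition x) : d.m < l := by
  have := d.h
  have := d.two_le_n
  omega

/-- The inner factor of `d'` is a factor of the inner factor of `d`. -/
def Nested (d d' : P.Decomposition x) : Prop :=
  ∃ (s : ℕ) (h₃ : d.m + 1 = s + d'.m) (h₄ : d'.n + 1 = d.n + s) (j : Fin s) (c : P.Op s),
    (d'.i : ℕ) = d.i + j ∧ d.b = P.comp h₃ j c d'.b ∧ d'.a = P.comp h₄ d.i d.a c

/-- The inner factors of `d'` and `d` are inserted, in this order, in different inputs of a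
common operation. -/
def Parallel (d d' : P.Decomposition x) : Prop :=
  ∃ (s : ℕ) (h₃ : d.n + 1 = s + d'.m) (h₄ : d'.n + 1 = s + d.m) (j j' : Fin s) (c : P.Op s),
    (j' : ℕ) < j ∧ (d'.i : ℕ) = j' ∧ (d.i : ℕ) = j + d'.m - 1 ∧
      d.a = P.comp h₃ j' c d'.b ∧ d'.a = P.comp h₄ j c d.b

/-- The composition of the images of the two factors of a decomposition. -/
def value {Q : NSOperad.{v}} (F : ∀ n, P.Op n → Q.Op n) (d : P.Decomposition x) : Q.Op l :=
  Q.comp d.h d.i (F _ d.a) (F _ d.b)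

/-- The two values are the two sides of `comp_assoc` in `Q`. Multiplicativity of `F` is needed only
on `d.b` and `d'.a`, whose arities are below `l`, so this can serve inside an induction on the
arity. -/
theorem value_eq_of_nested {Q : NSOperad.{v}} {F : ∀ n, P.Op n → Q.Op n}
    (hF : ∀ {n m p : ℕ} (h : p + 1 = n + m) (i : Fin n) (a : P.Op n) (b : P.Op m), p < l →
      F p (P.comp h i a b) = Q.comp h i (F n a) (F m b))
    {d d' : P.Decomposition x} (hd : d.Nested d') : d.value F = d'.value F := by
  obtain ⟨s, h₃, h₄, j, c, hi, hb, ha⟩ := hd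
  rw [value, value, hb, ha, hF _ _ _ _ d.m_lt, hF _ _ _ _ d'.n_lt,
    ← Q.comp_assoc h₄ d'.h h₃ d.h]
  congr 1
  exact Fin.ext hi.symm

/-- The two values are the two sides of `comp_comm` in `Q`; multiplicativity of `F` is used only on
the outer factors `d.a` and `d'.a`, again of arity below `l`. -/
theorem value_eq_of_parallel {Q : NSOperad.{v}} {F : ∀ n, P.Op n → Q.Op n}
    (hF : ∀ {n m p : ℕ} (h : p + 1 = n + m) (i : Fin n) (a : P.Op n) (b : P.Op m), p < l →
      F p (P.comp h i a b) = Q.comp h i (F n a) (F m b))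
    {d d' : P.Decomposition x} (hd : d.Parallel d') : d.value F = d'.value F := by
  obtain ⟨s, h₃, h₄, j, j', c, hj, hi', hi, ha, ha'⟩ := hd
  rw [value, value, ha, ha', hF _ _ _ _ d.n_lt, hF _ _ _ _ d'.n_lt]
  have key := Q.comp_comm h₄ d'.h h₃ d.h j j' hj (F _ c) (F _ d.b) (F _ d'.b)
  have e : d'.i = ⟨j', by have := d'.i.isLt; omega⟩ := Fin.ext hi'
  have e' : d.i = ⟨j + d'.m - 1, by have := d.i.isLt; omega⟩ := Fin.ext hi
  rw [e, e', key]

end Decomposition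

/-- Any two decompositions of an operation are nested or parallel. -/
def HasCompatibleDecompositions (P : NSOperad.{u}) : Prop :=
  ∀ {l : ℕ} {x : P.Op l} (d d' : P.Decomposition x),
    d.Nested d' ∨ d'.Nested d ∨ d.Parallel d' ∨ d'.Parallel d

/-! ### Freeness from compatible decompositions -/

section Extension

variable {P : NSOperad.{u}} {Q : NSOperad.{v}}

open Classical in
/-- The extension to `P` of a map defined on the indecomposable operations, by recursion on the
arity along an arbitrary choice of decompositions. -/
noncomputable def extend (hP : P.IsReduced) (φ : ∀ n, P.indecomposables n → Q.Op n) :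
    ∀ n, P.Op n → Q.Op n
  | 0, x => (hP.1.false x).elim
  -- By reducedness the argument is the unit, so no other value is possible.
  | 1, _ => Q.one
  | n + 2, x =>
    if hx : P.IsDecomposable x then
      have := (Classical.choice hx.nonempty_decomposition).n_lt
      have := (Classical.choice hx.nonempty_decomposition).m_lt
      Q.comp (Classical.choice hx.nonempty_decomposition).h
        (Classical.choice hx.nonempty_decomposition).i
        (extend hP φ _ (Classical.choice hx.nonempty_decomposition).a)
        (extend hP φ _ (Classical.choice hx.nonempty_decomposition).b)
    else φ (n + 2) ⟨x, Nat.le_add_left 2 n, hx⟩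
termination_by n => n

theorem extend_indecomposable (hP : P.IsReduced) (φ : ∀ n, P.indecomposables n → Q.Op n) (n : ℕ)
    (x : P.indecomposables n) : extend hP φ n x = φ n x := by
  obtain ⟨x, hx'⟩ := x
  obtain ⟨hn, hx⟩ := id hx'
  obtain ⟨n, rfl⟩ := Nat.exists_eq_add_of_le' hn
  rw [extend, dif_neg hx]

theorem extend_eq_value (hP : P.IsReduced) (φ : ∀ n, P.indecomposables n → Q.Op n) {l : ℕ}
    {x : P.Op l} (hx : P.IsDecomposable x) :
    ∃ d : P.Decomposition x, extend hP φ l x = d.value (extend hP φ) := by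
  obtain ⟨n, rfl⟩ : ∃ n, l = n + 2 := by
    obtain ⟨n, m, h, -, -, -, hn, hm, -⟩ := hx
    exact ⟨l - 2, by omega⟩
  refine ⟨Classical.choice hx.nonempty_decomposition, ?_⟩
  rw [extend, dif_pos hx]
  rfl

/-- The recursion used some chosen decomposition, but the given one is compatible with it, so both
have the same value once multiplicativity is known in smaller arities. Factors of arity 1 are units
and are treated apart. -/
theorem extend_comp (hP : P.IsReduced) (hP' : P.HasCompatibleDecompositions)
    (φ : ∀ n, P.indecomposables n → Q.Op n) {l : ℕ} : ∀ {n m : ℕ} (h : l + 1 = n + m) (i : Fin n)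
      (a : P.Op n) (b : P.Op m),
      extend hP φ l (P.comp h i a b) = Q.comp h i (extend hP φ n a) (extend hP φ m b) := by
  induction l using Nat.strong_induction_on with
  | _ l ih =>
  intro n m h i a b
  have hn : n ≠ 0 := fun e => by subst e; exact hP.1.false a
  have hm : m ≠ 0 := fun e => by subst e; exact hP.1.false b
  by_cases hn1 : n = 1
  · subst hn1
    obtain rfl : l = m := by omega
    rw [hP.2 a, Subsingleton.elim i 0, P.one_comp, extend, Q.one_comp]
  by_cases hm1 : m = 1
  · subst hm1
    obtain rfl : l = n := by omega
    rw [hP.2 b, P.comp_one, extend, Q.comp_one]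
  let d : P.Decomposition (P.comp h i a b) := ⟨n, m, h, i, a, b, by omega, by omega, rfl⟩
  obtain ⟨d', hd'⟩ := extend_eq_value hP φ d.isDecomposable
  rw [hd']
  change _ = d.value (extend hP φ)
  have hF : ∀ {n m p : ℕ} (h : p + 1 = n + m) (i : Fin n) (a : P.Op n) (b : P.Op m), p < l →
      extend hP φ p (P.comp h i a b) = Q.comp h i (extend hP φ n a) (extend hP φ m b) :=
    fun h i a b hp => ih _ hp h i a b
  rcases hP' d d' with hd | hd | hd | hd
  · exact (d.value_eq_of_nested hF hd).symm
  · exact d'.value_eq_of_nested hF hd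
  · exact (d.value_eq_of_parallel hF hd).symm
  · exact d'.value_eq_of_parallel hF hd

theorem Hom.ext {F G : Hom P Q} (h : ∀ n x, F.toFun n x = G.toFun n x) : F = G := by
  cases F
  cases G
  congr
  funext n x
  exact h n x

theorem Hom.ext_indecomposables (hP : P.IsReduced) {F G : Hom P Q}
    (h : ∀ (n : ℕ) (x : P.indecomposables n), F.toFun n x = G.toFun n x) : F = G := by
  refine Hom.ext fun n => ?_
  induction n using Nat.strong_induction_on with
  | _ l ih =>
  intro x
  by_cases hx : P.IsDecomposable x
  · obtain ⟨d⟩ := hx.nonempty_decomposition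
    rw [d.eq_comp, F.map_comp, G.map_comp, ih _ d.n_lt, ih _ d.m_lt]
  · match l, x, hx with
    | 0, x, _ => exact (hP.1.false x).elim
    | 1, x, _ => rw [hP.2 x, F.map_one, G.map_one]
    | l + 2, x, hx => exact h _ ⟨x, Nat.le_add_left 2 l, hx⟩

theorem isFreeOn_indecomposables (hP : P.IsReduced) (hP' : P.HasCompatibleDecompositions) :
    IsFreeOn.{u, v} P P.indecomposables := by
  intro Q φ
  refine ⟨⟨extend hP φ, by rw [extend], extend_comp hP hP' φ⟩, extend_indecomposable hP φ, ?_⟩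
  intro G hG
  refine Hom.ext_indecomposables hP fun n x => ?_
  exact (hG n x).trans (extend_indecomposable hP φ n x).symm

end Extension

/-! ### Passage to vector spaces -/

theorem isReduced_linearize {P : NSOperad.{v}} (hP : P.IsReduced) (k : Type u) [Field k] :
    (P.linearize k).IsReduced := by
  have := hP.1
  refine ⟨inferInstanceAs (Subsingleton (P.Op 0 →₀ k)), fun c c' hc => ?_, fun f => ?_⟩
  · have hc' : c • Finsupp.single P.one (1 : k) = c' • Finsupp.single P.one (1 : k) := hc
    simpa using DFunLike.congr_fun hc' P.one
  · let g : P.Op 1 →₀ k := f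
    refine ⟨g P.one, ?_⟩
    change g P.one • Finsupp.single P.one (1 : k) = g
    refine Finsupp.ext fun x => ?_
    rw [hP.2 x]
    simp

end NSOperad

namespace LinNSOperad

variable {k : Type u} [Field k]

/-- The set operad underlying a linear operad. -/
def toNSOperad (Q : LinNSOperad.{u, w} k) : NSOperad.{w} where
  Op := Q.Op
  one := Q.one
  comp h i a b := Q.comp h i a b
  comp_assoc := Q.comp_assoc
  comp_comm := Q.comp_comm
  one_comp := Q.one_comp
  comp_one := Q.comp_one

theorem linearCombination_linComp {P : NSOperad.{v}} {Q : LinNSOperad.{u, w} k}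
    (f : ∀ n, P.Op n → Q.Op n)
    (hf : ∀ {n m l : ℕ} (h : l + 1 = n + m) (i : Fin n) (a : P.Op n) (b : P.Op m),
      f l (P.comp h i a b) = Q.comp h i (f n a) (f m b))
    {n m l : ℕ} (h : l + 1 = n + m) (i : Fin n) (a : P.Op n →₀ k) (b : P.Op m →₀ k) :
    Finsupp.linearCombination k (f l) (P.linComp k h i a b) =
      Q.comp h i (Finsupp.linearCombination k (f n) a) (Finsupp.linearCombination k (f m) b) := by
  induction a using Finsupp.induction_linear with
  | zero => simp
  | add a a' ha ha' => simp only [map_add, LinearMap.add_apply, ha, ha']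
  | single a x =>
  induction b using Finsupp.induction_linear with
  | zero => simp
  | add b b' hb hb' => simp only [map_add, hb, hb']
  | single b y =>
    rw [P.linComp_single, Finsupp.linearCombination_single, Finsupp.linearCombination_single,
      Finsupp.linearCombination_single, hf, map_smul, map_smul, LinearMap.smul_apply, smul_smul,
      mul_comm]

/-- The linear extension of a morphism from a set operad to a linear operad. -/
noncomputable def Hom.ofSet {P : NSOperad.{v}} {Q : LinNSOperad.{u, w} k}
    (F : NSOperad.Hom P Q.toNSOperad) : Hom (P.linearize k) Q where
  toFun n := Finsupp.linearCombination k (F.toFun n : P.Op n → Q.Op n)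
  map_one := by
    exact (Finsupp.linearCombination_single k _ _).trans ((one_smul k _).trans F.map_one)
  map_comp h i a b := linearCombination_linComp F.toFun F.map_comp h i a b

theorem Hom.ofSet_single {P : NSOperad.{v}} {Q : LinNSOperad.{u, w} k}
    (F : NSOperad.Hom P Q.toNSOperad) {n : ℕ} (x : P.Op n) :
    (Hom.ofSet F).toFun n (Finsupp.single x (1 : k)) = F.toFun n x :=
  (Finsupp.linearCombination_single k _ _).trans (one_smul k _)

/-- The restriction to the basis of a morphism defined on the linearization of a set operad. -/
noncomputable def Hom.toSet {P : NSOperad.{v}} {Q : LinNSOperad.{u, w} k}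
    (F : Hom (P.linearize k) Q) : NSOperad.Hom P Q.toNSOperad where
  toFun n x := F.toFun n (Finsupp.single x (1 : k))
  map_one := F.map_one
  map_comp {n m l} h i a b := by
    refine Eq.trans ?_ (F.map_comp h i (Finsupp.single a (1 : k)) (Finsupp.single b (1 : k)))
    refine congrArg (F.toFun l) ?_
    refine Eq.trans ?_ (P.linComp_single h i a b 1 1).symm
    rw [mul_one]

theorem Hom.ext_single {P : NSOperad.{v}} {Q : LinNSOperad.{u, w} k}
    {F G : Hom (P.linearize k) Q}
    (h : ∀ n x, F.toFun n (Finsupp.single x (1 : k)) = G.toFun n (Finsupp.single x (1 : k))) :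
    F = G := by
  have : F.toFun = G.toFun := by
    funext n
    exact Finsupp.lhom_ext' fun x => LinearMap.ext_ring (h n x)
  cases F
  cases G
  congr

/-- Restriction to the basis and linear extension identify morphisms `P.linearize k → Q` with
morphisms `P → Q.toNSOperad`, while a linear map on the span of `E n` is determined by its values on
`E n`. Both existence and uniqueness are thus inherited from the set operad. -/
theorem isFreeOn_linearize {P : NSOperad.{v}} {E : ∀ n, Set (P.Op n)}
    (hP : NSOperad.IsFreeOn.{v, w} P E) :
    IsFreeOn.{u, max v u, w} (P.linearize k)
      (fun n => Submodule.span k ((fun x : P.Op n => Finsupp.single x (1 : k)) '' E n)) := by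
  intro Q φ
  have mem : ∀ (n : ℕ) (x : E n), (Finsupp.single (x : P.Op n) (1 : k) : (P.linearize k).Op n) ∈
      Submodule.span k ((fun x : P.Op n => Finsupp.single x (1 : k)) '' E n) :=
    fun n x => Submodule.subset_span ⟨x, x.2, rfl⟩
  obtain ⟨F, hF, hF'⟩ := hP Q.toNSOperad fun n x => φ n ⟨_, mem n x⟩
  refine ⟨Hom.ofSet F, ?_, ?_⟩
  · rintro n ⟨x, hx⟩
    induction hx using Submodule.span_induction with
    | mem x hx =>
      obtain ⟨x, hx, rfl⟩ := hx
      exact (Hom.ofSet_single F x).trans (hF n ⟨x, hx⟩)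
    | zero => exact (map_zero _).trans (map_zero (φ n)).symm
    | add x y hx hy hx' hy' =>
      refine (map_add _ x y).trans ?_
      rw [hx', hy', ← map_add]
      rfl
    | smul c x hx hx' =>
      refine (map_smul _ c x).trans ?_
      rw [hx', ← map_smul]
      rfl
  · intro G hG
    have hG' : G.toSet = F := hF' _ fun n x => hG n ⟨_, mem n x⟩
    refine Hom.ext_single fun n x => ?_
    rw [Hom.ofSet_single, ← hG']
    rfl

end LinNSOperad

/-! ### Modules of a tree: intervals occupied by an inner factor -/

namespace LabelledTree

/-- The vertex `x` belongs to the interval of length `m` starting at `i`. -/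
def InBlock {l : ℕ} (i m : ℕ) (x : Fin l) : Prop :=
  i ≤ x ∧ (x : ℕ) < i + m

/-- The vertices `i, …, i + m - 1` are those of a subtree with root `r`, and a vertex outside of
this subtree with outgoing vertex inside of it is grafted on its largest or on its smallest
vertex, according to whether its label is smaller or larger than those of the subtree. -/
structure IsModule {l : ℕ} (T : LabelledTree l) (i m : ℕ) (r : Fin l) : Prop where
  root_mem : InBlock i m r
  parent_mem : ∀ x, InBlock i m x → x ≠ r → ∃ y, InBlock i m y ∧ T.parent x = some y
  parent_root_notMem : ∀ y, T.parent r = some y → ¬ InBlock i m y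
  eq_max : ∀ a x : Fin l, (a : ℕ) < i → InBlock i m x → T.parent a = some x → (x : ℕ) + 1 = i + m
  eq_min : ∀ a x : Fin l, i + m ≤ (a : ℕ) → InBlock i m x → T.parent a = some x → (x : ℕ) = i

/-- The path from any element would stay in `s` up to the root, which has no parent. This is how
acyclicity of the tree enters the later contradictions. -/
theorem notMem_of_parent_mem {l : ℕ} (T : LabelledTree l) (s : Set (Fin l))
    (hs : ∀ x ∈ s, ∃ y ∈ s, T.parent x = some y) (x : Fin l) : x ∉ s := by
  induction T.path_root x using Relation.ReflTransGen.head_induction_on with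
  | refl =>
    intro hx
    obtain ⟨y, -, e⟩ := hs _ hx
    rw [T.parent_root] at e
    simp at e
  | head hab _ ih =>
    intro hx
    obtain ⟨y, hy, e⟩ := hs _ hx
    rw [hab] at e
    exact ih (Option.some.inj e ▸ hy)

/-- Let `I` and `J` be the overlapping intervals, `I` on the left. According to the position of the
two roots, `I \ J`, `J \ I` or `I ∩ J` contains no root of a module in which its parents are
controlled, hence is closed under parents; being nonempty, it contradicts `notMem_of_parent_mem`. -/
theorem IsModule.not_overlap {l : ℕ} {T : LabelledTree l} {i m i' m' : ℕ} {r r' : Fin l}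
    (hr : T.IsModule i m r) (hr' : T.IsModule i' m' r') (h₁ : i < i') (h₂ : i' < i + m)
    (h₃ : i + m < i' + m') (h₄ : i' + m' ≤ l) : False := by
  obtain ⟨hi, hm⟩ := hr.root_mem
  obtain ⟨hi', hm'⟩ := hr'.root_mem
  -- An edge from the left of `J` into `I ∩ J` would have to end at the last vertex of `J`, which
  -- lies outside `I`.
  have left : ∀ x y : Fin l, (x : ℕ) < i' → InBlock i m y → T.parent x = some y → (y : ℕ) < i' := by
    intro x y hx hy e
    by_contra hlt
    have hy₂ := hy.2
    have := hr'.eq_max x y hx ⟨by omega, by omega⟩ e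
    omega
  -- An edge from the right of `I` into `I ∩ J` would have to end at the first vertex of `I`, which
  -- lies outside `J`.
  have right : ∀ x y : Fin l, i + m ≤ x → InBlock i' m' y → T.parent x = some y →
      i + m ≤ y := by
    intro x y hx hy e
    by_contra hlt
    have hy₁ := hy.1
    have := hr.eq_min x y hx ⟨by omega, by omega⟩ e
    omega
  -- The root of `I` lies in `J` or beyond, so every vertex of `I \ J` has its parent in `I`, and by
  -- `left` in `I \ J`.
  by_cases hrJ : i' ≤ r
  · refine T.notMem_of_parent_mem {x | i ≤ (x : ℕ) ∧ (x : ℕ) < i'} ?_ ⟨i, by omega⟩ ⟨le_rfl, h₁⟩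
    rintro x ⟨hx₁, hx₂⟩
    obtain ⟨y, hy, e⟩ := hr.parent_mem x ⟨hx₁, by omega⟩ (by rintro rfl; omega)
    exact ⟨y, ⟨hy.1, left x y hx₂ hy e⟩, e⟩
  by_cases hrI : (r' : ℕ) < i + m
  · refine T.notMem_of_parent_mem {x | i + m ≤ (x : ℕ) ∧ (x : ℕ) < i' + m'} ?_
      ⟨i + m, by omega⟩ ⟨le_rfl, h₃⟩
    rintro x ⟨hx₁, hx₂⟩
    obtain ⟨y, hy, e⟩ := hr'.parent_mem x ⟨by omega, hx₂⟩ (by rintro rfl; omega)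
    exact ⟨y, ⟨right x y hx₁ hy e, hy.2⟩, e⟩
  -- Neither root lies in `I ∩ J`, so the parent of a vertex of `I ∩ J` lies in both intervals.
  · refine T.notMem_of_parent_mem {x | i' ≤ (x : ℕ) ∧ (x : ℕ) < i + m} ?_ ⟨i', by omega⟩
      ⟨le_rfl, h₂⟩
    rintro x ⟨hx₁, hx₂⟩
    obtain ⟨y, hy, e⟩ := hr.parent_mem x ⟨by omega, hx₂⟩ (by rintro rfl; omega)
    obtain ⟨y', hy', e'⟩ := hr'.parent_mem x ⟨hx₁, by omega⟩ (by rintro rfl; omega)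
    obtain rfl : y = y' := Option.some.inj (e.symm.trans e')
    exact ⟨y, ⟨hy'.1, hy.2⟩, e⟩

/-! ### Edges and modules of a composite -/

section Composition

variable {n m l : ℕ} (h : l + 1 = n + m) (i : Fin n)

theorem embS_injective : Function.Injective (embS h i) := by
  intro a b e
  have := congrArg Fin.val e
  simp only [embS] at this
  exact Fin.ext (by omega)

theorem embT_injOn (hm : 0 < m) {a b : Fin n} (ha : a ≠ i) (hb : b ≠ i)
    (e : embT h hm i a = embT h hm i b) : a = b := by
  have := congrArg (origin h i) e
  rw [origin_embT h hm i a ha, origin_embT h hm i b hb] at this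
  exact Sum.inl.inj this

theorem embT_ne_embS (hm : 0 < m) {a : Fin n} (ha : a ≠ i) (b : Fin m) :
    embT h hm i a ≠ embS h i b := by
  intro e
  have := congrArg (origin h i) e
  rw [origin_embT h hm i a ha, origin_embS h i b] at this
  simp at this

theorem inBlock_embS (b : Fin m) : InBlock i m (embS h i b) :=
  ⟨Nat.le_add_left _ _, by simp only [embS]; omega⟩

theorem InBlock.exists_eq_embS {x : Fin l} (hx : InBlock i m x) : ∃ b, x = embS h i b :=
  ⟨⟨x - i, by have := hx.1; have := hx.2; omega⟩, Fin.ext (by have := hx.1; simp only [embS]; omega)⟩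

theorem not_inBlock_embT (hm : 0 < m) {a : Fin n} (ha : a ≠ i) :
    ¬ InBlock i m (embT h hm i a) := by
  intro hx
  obtain ⟨b, hb⟩ := hx.exists_eq_embS h i
  exact embT_ne_embS h i hm ha b hb

theorem embT_lt_iff (hm : 0 < m) (a : Fin n) (ha : a ≠ i) : (embT h hm i a : ℕ) < i ↔ a < i := by
  have ha' : (a : ℕ) ≠ i := fun e => ha (Fin.ext e)
  simp only [embT, Fin.lt_def]
  split_ifs <;> omega

variable (T : LabelledTree n) (S : LabelledTree m)

theorem compMax_parent_embS_eq_some {b : Fin m} (b' : Fin m) :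
    (compMax h i T S).parent (embS h i b) = some (embS h i b') ↔ S.parent b = some b' := by
  rw [compMax_parent_S h S.root.pos]
  rcases S.parent b with _ | c
  · rcases hT : T.parent i with _ | v
    · simp
    · have hv : v ≠ i := fun e => parent_ne_self T i (e ▸ hT)
      simp [embT_ne_embS h i _ hv]
  · simp [(embS_injective h i).eq_iff]

theorem compMax_parent_embT_eq_embT {a a' : Fin n} (ha : a ≠ i) (ha' : a' ≠ i) :
    (compMax h i T S).parent (embT h S.root.pos i a) = some (embT h S.root.pos i a') ↔
      T.parent a = some a' := by
  rw [compMax_parent_T h S.root.pos i T S a ha]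
  rcases T.parent a with _ | c
  · simp
  · by_cases hc : c = i
    · simp [hc, ha'.symm, (embT_ne_embS h i S.root.pos ha' _).symm]
    · simp only [Option.map_some, if_neg hc, Option.some.injEq]
      exact ⟨embT_injOn h i _ hc ha', fun e => e ▸ rfl⟩

theorem compMax_parent_root_eq_embT {a' : Fin n} (ha' : a' ≠ i) :
    (compMax h i T S).parent (embS h i S.root) = some (embT h S.root.pos i a') ↔
      T.parent i = some a' := by
  rw [compMax_parent_S h S.root.pos, S.parent_root]
  rcases hT : T.parent i with _ | c
  · simp
  · have hc : c ≠ i := fun e => parent_ne_self T i (e ▸ hT)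
    simp only [Option.map_some, Option.some.injEq]
    exact ⟨embT_injOn h i _ hc ha', fun e => e ▸ rfl⟩

theorem compMax_parent_embT_eq_embS {a : Fin n} (ha : a ≠ i) (b : Fin m) :
    (compMax h i T S).parent (embT h S.root.pos i a) = some (embS h i b) ↔
      T.parent a = some i ∧ b = fMax S.root.pos i a := by
  rw [compMax_parent_T h S.root.pos i T S a ha]
  rcases T.parent a with _ | c
  · simp
  · by_cases hc : c = i
    · simp [hc, (embS_injective h i).eq_iff, eq_comm]
    · simp [hc, embT_ne_embS h i S.root.pos hc]

theorem parent_eq_some_of_ne_root {l : ℕ} (T : LabelledTree l) {x : Fin l} (hx : x ≠ T.root) :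
    ∃ y, T.parent x = some y := by
  rcases Relation.ReflTransGen.cases_head (T.path_root x) with e | ⟨y, hy, -⟩
  · exact (hx e).elim
  · exact ⟨y, hy⟩

theorem isModule_compMax : (compMax h i T S).IsModule i m (embS h i S.root) where
  root_mem := inBlock_embS h i _
  parent_mem x hx hxr := by
    obtain ⟨b, rfl⟩ := hx.exists_eq_embS h i
    obtain ⟨b', hb'⟩ := S.parent_eq_some_of_ne_root (fun e => hxr (congrArg _ e))
    exact ⟨_, inBlock_embS h i b', (compMax_parent_embS_eq_some h i T S b').2 hb'⟩
  parent_root_notMem y e hy := by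
    obtain ⟨b, rfl⟩ := hy.exists_eq_embS h i
    rw [compMax_parent_embS_eq_some, S.parent_root] at e
    simp at e
  eq_max x y hx hy e := by
    obtain ⟨b, rfl⟩ := hy.exists_eq_embS h i
    rcases eq_embT_or_eq_embS h S.root.pos i x with ⟨a, ha, rfl⟩ | ⟨c, rfl⟩
    · rw [embT_lt_iff h i _ a ha] at hx
      rw [compMax_parent_embT_eq_embS h i T S ha] at e
      have := S.root.pos
      simp only [embS, e.2, fMax, if_pos hx]
      omega
    · have := (inBlock_embS h i c).1
      omega
  eq_min x y hx hy e := by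
    obtain ⟨b, rfl⟩ := hy.exists_eq_embS h i
    rcases eq_embT_or_eq_embS h S.root.pos i x with ⟨a, ha, rfl⟩ | ⟨c, rfl⟩
    · have hx' : ¬ a < i := by
        rw [← embT_lt_iff h i S.root.pos a ha]
        omega
      rw [compMax_parent_embT_eq_embS h i T S ha] at e
      simp [embS, e.2, fMax, if_neg hx']
    · have := (inBlock_embS h i c).2
      omega

/-- Every edge of either factor can be read off the composite: edges at `i` leave from the root of
`S`, and edges into `i` arrive at the vertex prescribed by `fMax`. Comparing `S` first makes that
root common to both sides. -/
theorem compMax_injective {T T' : LabelledTree n} {S S' : LabelledTree m}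
    (e : compMax h i T S = compMax h i T' S') : T = T' ∧ S = S' := by
  have hS : S = S' := by
    refine ext_parent fun b => Option.ext fun b' => ?_
    rw [← compMax_parent_embS_eq_some h i T S, e, compMax_parent_embS_eq_some]
  subst hS
  refine ⟨ext_parent fun a => Option.ext fun a' => ?_, rfl⟩
  by_cases ha : a = i
  · subst ha
    by_cases ha' : a' = a
    · subst ha'
      simp [parent_ne_self]
    · rw [← compMax_parent_root_eq_embT h a T S ha', e, compMax_parent_root_eq_embT h a T' S ha']
  · by_cases ha' : a' = i
    · subst ha'
      have key := compMax_parent_embT_eq_embS h a' T S ha (fMax S.root.pos a' a)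
      rw [e, compMax_parent_embT_eq_embS h a' T' S ha] at key
      simpa using key.symm
    · rw [← compMax_parent_embT_eq_embT h i T S ha ha', e,
        compMax_parent_embT_eq_embT h i T' S ha ha']

/-- The module lies inside the block of `S`, where the composite has exactly the edges of `S`. -/
theorem IsModule.of_nested {j m' : ℕ} {r : Fin l}
    (hr : (compMax h i T S).IsModule (i + j) m' r) (hj : j + m' ≤ m) :
    ∃ r', S.IsModule j m' r' := by
  have mem : ∀ b : Fin m, InBlock (i + j) m' (embS h i b) ↔ InBlock j m' b := by
    intro b
    simp only [InBlock, embS]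
    omega
  have exists_eq : ∀ x : Fin l, InBlock (i + j) m' x → ∃ b, x = embS h i b :=
    fun x hx => InBlock.exists_eq_embS h i ⟨by have := hx.1; omega, by have := hx.2; omega⟩
  obtain ⟨r', rfl⟩ := exists_eq _ hr.root_mem
  refine ⟨r', (mem r').1 hr.root_mem, ?_, ?_, ?_, ?_⟩
  · intro b hb hbr
    obtain ⟨y, hy, e⟩ := hr.parent_mem _ ((mem b).2 hb) ((embS_injective h i).ne hbr)
    obtain ⟨b', rfl⟩ := exists_eq _ hy
    exact ⟨b', (mem b').1 hy, (compMax_parent_embS_eq_some h i T S b').1 e⟩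
  · intro b hb
    rw [← mem]
    exact hr.parent_root_notMem _ ((compMax_parent_embS_eq_some h i T S b).2 hb)
  · intro b c hb hc e
    have := hr.eq_max (embS h i b) (embS h i c) (by simp only [embS]; omega) ((mem c).2 hc)
      ((compMax_parent_embS_eq_some h i T S c).2 e)
    simp only [embS] at this
    omega
  · intro b c hb hc e
    have := hr.eq_min (embS h i b) (embS h i c) (by simp only [embS]; omega) ((mem c).2 hc)
      ((compMax_parent_embS_eq_some h i T S c).2 e)
    simp only [embS] at this
    omega

/-- Vertices of `T` to the left of `i` keep their labels and the edges among them. Having only the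
left side suffices, since two disjoint blocks can be taken in either order. -/
theorem IsModule.of_left {j m' : ℕ} {r : Fin l}
    (hr : (compMax h i T S).IsModule j m' r) (hj : j + m' ≤ i) :
    ∃ r', T.IsModule j m' r' := by
  have hm := S.root.pos
  have ne : ∀ a : Fin n, InBlock j m' a → a ≠ i := by
    rintro a ha rfl
    have := ha.2
    omega
  have val : ∀ a : Fin n, InBlock j m' a → (embT h hm i a : ℕ) = a := by
    intro a ha
    have := ha.2
    simp only [embT]
    rw [if_pos (by omega)]
  have mem : ∀ a : Fin n, InBlock j m' a → InBlock j m' (embT h hm i a) := by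
    intro a ha
    rw [InBlock, val a ha]
    exact ha
  have exists_eq : ∀ x : Fin l, InBlock j m' x → ∃ a, InBlock j m' a ∧ x = embT h hm i a := by
    intro x hx
    have := hx.2
    have ha : InBlock j m' (⟨x, by omega⟩ : Fin n) := hx
    exact ⟨_, ha, Fin.ext (val _ ha).symm⟩
  obtain ⟨r', hr', rfl⟩ := exists_eq _ hr.root_mem
  refine ⟨r', hr', ?_, ?_, ?_, ?_⟩
  · intro a ha har
    obtain ⟨y, hy, e⟩ := hr.parent_mem _ (mem a ha)
      (fun e => har (embT_injOn h i hm (ne a ha) (ne r' hr') e))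
    obtain ⟨a', ha', rfl⟩ := exists_eq _ hy
    exact ⟨a', ha', (compMax_parent_embT_eq_embT h i T S (ne a ha) (ne a' ha')).1 e⟩
  · intro a e ha
    exact hr.parent_root_notMem _
      ((compMax_parent_embT_eq_embT h i T S (ne r' hr') (ne a ha)).2 e) (mem a ha)
  · intro a c ha hc e
    have hai : a ≠ i := by
      rintro rfl
      omega
    have := hr.eq_max (embT h hm i a) _ (by simp only [embT]; split_ifs <;> omega) (mem c hc)
      ((compMax_parent_embT_eq_embT h i T S hai (ne c hc)).2 e)
    rwa [val c hc] at this
  · intro a c ha hc e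
    rw [← val c hc]
    -- The vertex `i` is no longer present in the composite; its outgoing edge is carried by the
    -- root of `S`, whose label is also to the right of the module.
    by_cases hai : a = i
    · subst hai
      exact hr.eq_min (embS h a S.root) _ (by simp only [embS]; omega) (mem c hc)
        ((compMax_parent_root_eq_embT h a T S (ne c hc)).2 e)
    · exact hr.eq_min (embT h hm i a) _ (by simp only [embT]; split_ifs <;> omega) (mem c hc)
        ((compMax_parent_embT_eq_embT h i T S hai (ne c hc)).2 e)

end Composition

/-! ### Factoring a tree through a module -/

section Factorization

variable {n m l : ℕ} (h : l + 1 = n + m) (i : Fin n) {T : LabelledTree l} {r : Fin l}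

/-- The vertex of the quotient tree corresponding to a vertex of the big tree. -/
def collapse (x : Fin l) : Fin n :=
  (origin h i x : Fin n ⊕ Fin m).elim id fun _ => i

theorem collapse_embT (hm : 0 < m) {a : Fin n} (ha : a ≠ i) :
    collapse h i (embT h hm i a) = a := by
  rw [collapse, origin_embT h hm i a ha]
  rfl

theorem collapse_embS (b : Fin m) : collapse h i (embS h i b) = i := by
  rw [collapse, origin_embS]
  rfl

theorem collapse_of_inBlock {x : Fin l} (hx : InBlock i m x) : collapse h i x = i := by
  obtain ⟨b, rfl⟩ := hx.exists_eq_embS h i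
  exact collapse_embS h i b

/-- The converse of `isModule_compMax`: `B` is the restriction of the tree to the block and `A` the
quotient contracting the block to `i`. The conditions `eq_max` and `eq_min` say that the attachments
lost in the quotient are those restored by `fMax`. -/
theorem IsModule.exists_eq_compMax (hr : T.IsModule i m r) :
    ∃ (A : LabelledTree n) (B : LabelledTree m), T = compMax h i A B := by
  obtain ⟨r₀, rfl⟩ := hr.root_mem.exists_eq_embS h i
  have hm := r₀.pos
  -- The block is represented by its root, the only vertex of the block whose parent can lie outside
  -- of it.
  let σ : Fin n → Fin l := fun a => if a = i then embS h i r₀ else embT h hm i a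
  have hσ : ∀ a, collapse h i (σ a) = a := by
    intro a
    by_cases ha : a = i
    · simp only [σ, ha, ↓reduceIte, collapse_embS]
    · simp only [σ, if_neg ha, collapse_embT h i hm ha]
  let pA : Fin n → Option (Fin n) := fun a => (T.parent (σ a)).map (collapse h i)
  let pB : Fin m → Option (Fin m) := fun b =>
    (T.parent (embS h i b)).bind fun y => (origin h i y).getRight?
  have step : ∀ x y : Fin l, T.parent x = some y →
      Relation.ReflTransGen (fun a b => pA a = some b) (collapse h i x) (collapse h i y) := by
    intro x y e
    rcases eq_embT_or_eq_embS h hm i x with ⟨a, ha, rfl⟩ | ⟨b, rfl⟩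
    · rw [collapse_embT h i hm ha]
      exact .single (by simp only [pA, σ, if_neg ha, e, Option.map_some])
    · rw [collapse_embS]
      by_cases hb : b = r₀
      · subst hb
        exact .single (by simp only [pA, σ, ↓reduceIte, e, Option.map_some])
      -- An edge leaving a vertex of the block other than its root stays in the block, so it
      -- collapses to the empty path.
      · obtain ⟨z, hz, e'⟩ := hr.parent_mem _ (inBlock_embS h i b) ((embS_injective h i).ne hb)
        obtain rfl : y = z := Option.some.inj (e.symm.trans e')
        rw [collapse_of_inBlock h i hz]
  have rootA : pA (collapse h i T.root) = none := by
    -- If the root of the tree lies in the block, it is the root of the block, because every other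
    -- vertex there has a parent.
    have : σ (collapse h i T.root) = T.root := by
      rcases eq_embT_or_eq_embS h hm i T.root with ⟨a, ha, e⟩ | ⟨b, e⟩
      · rw [e, collapse_embT h i hm ha]
        simp only [σ, if_neg ha]
      · rw [e, collapse_embS]
        simp only [σ, ↓reduceIte]
        by_contra hne
        obtain ⟨z, -, e'⟩ := hr.parent_mem T.root (e ▸ inBlock_embS h i b)
          (fun e'' => hne (e''.symm.trans e))
        rw [T.parent_root] at e'
        simp at e'
    simp only [pA, this, T.parent_root, Option.map_none]
  have rootB : pB r₀ = none := by
    rcases e : T.parent (embS h i r₀) with _ | y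
    · simp only [pB, e, Option.bind_none]
    · have hy := hr.parent_root_notMem y e
      rcases eq_embT_or_eq_embS h hm i y with ⟨a, ha, rfl⟩ | ⟨b, rfl⟩
      · simp only [pB, e, Option.bind_some, origin_embT h hm i a ha, Sum.getRight?_inl]
      · exact (hy (inBlock_embS h i b)).elim
  have stepB : ∀ b, b ≠ r₀ → ∃ b', T.parent (embS h i b) = some (embS h i b') ∧
      pB b = some b' := by
    intro b hb
    obtain ⟨y, hy, e⟩ := hr.parent_mem _ (inBlock_embS h i b) ((embS_injective h i).ne hb)
    obtain ⟨b', rfl⟩ := hy.exists_eq_embS h i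
    exact ⟨b', e, by simp only [pB, e, Option.bind_some, origin_embS, Sum.getRight?_inr]⟩
  let A : LabelledTree n :=
    { root := collapse h i T.root
      parent := pA
      parent_root := rootA
      path_root := by
        intro a
        rw [← hσ a]
        generalize σ a = x
        induction T.path_root x using Relation.ReflTransGen.head_induction_on with
        | refl => exact .refl
        | head e _ ih => exact (step _ _ e).trans ih }
  let B : LabelledTree m :=
    { root := r₀
      parent := pB
      parent_root := rootB
      path_root := by
        intro b
        by_contra hb
        -- The vertices of the block that do not reach `r₀` form a set closed under parents, hence
        -- empty.
        refine T.notMem_of_parent_mem {x | ∃ b, x = embS h i b ∧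
          ¬ Relation.ReflTransGen (fun x y => pB x = some y) b r₀} ?_ _ ⟨b, rfl, hb⟩
        rintro _ ⟨b, rfl, hb⟩
        obtain ⟨b', e, e'⟩ := stepB b (by rintro rfl; exact hb .refl)
        exact ⟨_, ⟨b', rfl, fun hb' => hb (.head e' hb')⟩, e⟩ }
  refine ⟨A, B, ext_parent fun x => ?_⟩
  rcases eq_embT_or_eq_embS h hm i x with ⟨a, ha, rfl⟩ | ⟨b, rfl⟩
  · rw [compMax_parent_T h hm i A B a ha]
    have eA : A.parent a = (T.parent (embT h hm i a)).map (collapse h i) := by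
      simp only [A, pA, σ, if_neg ha]
    rw [eA]
    rcases e : T.parent (embT h hm i a) with _ | y
    · rfl
    simp only [Option.map_some, Option.some.injEq]
    rcases eq_embT_or_eq_embS h hm i y with ⟨a', ha', rfl⟩ | ⟨b, rfl⟩
    · rw [collapse_embT h i hm ha', if_neg ha']
    · rw [collapse_embS, if_pos rfl]
      apply Fin.ext
      by_cases hai : a < i
      · have := hr.eq_max _ _ ((embT_lt_iff h i hm a ha).2 hai) (inBlock_embS h i b) e
        simp only [embS, fMax, if_pos hai] at this ⊢
        omega
      · have hge : i + m ≤ (embT h hm i a : ℕ) := by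
          have h₁ := (embT_lt_iff h i hm a ha).not.2 hai
          have h₂ := not_inBlock_embT h i hm ha
          simp only [InBlock] at h₂
          omega
        have := hr.eq_min _ _ hge (inBlock_embS h i b) e
        simp only [embS, fMax, if_neg hai] at this ⊢
        omega
  · rw [compMax_parent_S h hm]
    by_cases hb : b = r₀
    · subst hb
      have eB : B.parent b = none := rootB
      have eA : A.parent i = (T.parent (embS h i b)).map (collapse h i) := by
        simp only [A, pA, σ, ↓reduceIte]
      rw [eB, eA]
      rcases e : T.parent (embS h i b) with _ | y
      · rfl
      · have hy := hr.parent_root_notMem y e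
        rcases eq_embT_or_eq_embS h hm i y with ⟨a, ha, rfl⟩ | ⟨c, rfl⟩
        · simp only [Option.map_some, collapse_embT h i hm ha]
        · exact (hy (inBlock_embS h i c)).elim
    · obtain ⟨b', e, e'⟩ := stepB b hb
      have eB : B.parent b = some b' := e'
      rw [eB, e]

end Factorization

end LabelledTree

/-! ### Compatibility of decompositions in `TMax` -/

open LabelledTree

namespace TMax

theorem isReduced : TMax.IsReduced := by
  refine ⟨⟨fun T : LabelledTree 0 => T.root.elim0⟩, fun T : LabelledTree 1 => ?_⟩
  refine ext_parent (S := LabelledTree.single) fun a => ?_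
  rw [Subsingleton.elim a T.root, T.parent_root]
  rfl

/-- The block of `d'` is a module of `d.b`, so `d.b = C ∘ B`. Reassociating gives a second
decomposition of `x` with the same block as `d'`, and injectivity identifies its factors with `d'.a`
and `d'.b`. -/
theorem nested {l : ℕ} {x : TMax.Op l} (d d' : TMax.Decomposition x) (h₁ : (d.i : ℕ) ≤ d'.i)
    (h₂ : (d'.i : ℕ) + d'.m ≤ d.i + d.m) : d.Nested d' := by
  have hd := d.h
  have hd' := d'.h
  have := d'.two_le_m
  have hi := d.i.isLt
  have mod := isModule_compMax d'.h d'.i d'.a d'.b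
  have e : compMax d'.h d'.i d'.a d'.b = compMax d.h d.i d.a d.b := d'.eq_comp.symm.trans d.eq_comp
  obtain ⟨j, hj⟩ := Nat.exists_eq_add_of_le h₁
  rw [e, hj] at mod
  obtain ⟨r, hr⟩ := mod.of_nested d.h d.i d.a d.b (by omega)
  obtain ⟨s, hs⟩ : ∃ s, d.m + 1 = s + d'.m := ⟨d.m + 1 - d'.m, by omega⟩
  have hn : d'.n + 1 = d.n + s := by omega
  have hjs : j < s := by omega
  obtain ⟨C, B, hB⟩ := IsModule.exists_eq_compMax hs ⟨j, hjs⟩ hr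
  have key := compMax_assoc hn d'.h hs d.h d.i ⟨j, hjs⟩ d.a C B
  rw [← hB, ← e] at key
  have ei : (⟨d.i + j, by omega⟩ : Fin d'.n) = d'.i := Fin.ext hj.symm
  rw [ei] at key
  obtain ⟨ha, rfl⟩ := compMax_injective d'.h d'.i key
  exact ⟨s, hs, hn, ⟨j, hjs⟩, C, hj, hB, ha.symm⟩

/-- The block of `d'` is a module of `d.a`, so `d.a = C ∘ B`. Exchanging the two insertions gives a
decomposition of `x` with the block of `d'`, and injectivity concludes. -/
theorem parallel {l : ℕ} {x : TMax.Op l} (d d' : TMax.Decomposition x)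
    (h₁ : (d'.i : ℕ) + d'.m ≤ d.i) : d.Parallel d' := by
  have hd := d.h
  have hd' := d'.h
  have := d'.two_le_m
  have hi := d.i.isLt
  have mod := isModule_compMax d'.h d'.i d'.a d'.b
  have e : compMax d'.h d'.i d'.a d'.b = compMax d.h d.i d.a d.b := d'.eq_comp.symm.trans d.eq_comp
  rw [e] at mod
  obtain ⟨r, hr⟩ := mod.of_left d.h d.i d.a d.b h₁
  obtain ⟨s, hs⟩ : ∃ s, d.n + 1 = s + d'.m := ⟨d.n + 1 - d'.m, by omega⟩
  have hn : d'.n + 1 = s + d.m := by omega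
  have hjs' : (d'.i : ℕ) < s := by omega
  -- The input `d.i` of `d.a`, renumbered in `C`, where the `d'.m` inputs of the block to its left
  -- are merged into one.
  have hjs : d.i + 1 - d'.m < s := by omega
  obtain ⟨C, B, hB⟩ := IsModule.exists_eq_compMax hs ⟨d'.i, hjs'⟩ hr
  have hlt : (d'.i : ℕ) < d.i + 1 - d'.m := by omega
  have hj : (d.i : ℕ) = d.i + 1 - d'.m + d'.m - 1 := by omega
  have key := compMax_comm hn d'.h hs d.h ⟨d.i + 1 - d'.m, hjs⟩ ⟨d'.i, hjs'⟩ hlt C d.b B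
  have ei : (⟨d.i + 1 - d'.m + d'.m - 1, by omega⟩ : Fin d.n) = d.i := Fin.ext hj.symm
  rw [← hB, ei, ← e] at key
  obtain ⟨ha, rfl⟩ := compMax_injective d'.h d'.i key
  exact ⟨s, hs, hn, ⟨d.i + 1 - d'.m, hjs⟩, ⟨d'.i, hjs'⟩, C, hlt, rfl, hj, hB, ha.symm⟩

theorem not_overlap {l : ℕ} {x : TMax.Op l} (d d' : TMax.Decomposition x) (h₁ : (d.i : ℕ) < d'.i)
    (h₂ : (d'.i : ℕ) < d.i + d.m) (h₃ : (d.i : ℕ) + d.m < d'.i + d'.m) : False := by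
  have mod := isModule_compMax d.h d.i d.a d.b
  have e : compMax d.h d.i d.a d.b = compMax d'.h d'.i d'.a d'.b := d.eq_comp.symm.trans d'.eq_comp
  rw [e] at mod
  exact mod.not_overlap (isModule_compMax d'.h d'.i d'.a d'.b) h₁ h₂ h₃
    (by have := d'.h; have := d'.i.isLt; omega)

theorem hasCompatibleDecompositions : TMax.HasCompatibleDecompositions := by
  intro l x d d'
  by_cases h₁ : (d'.i : ℕ) + d'.m ≤ d.i
  · exact .inr (.inr (.inl (parallel d d' h₁)))
  by_cases h₂ : (d.i : ℕ) + d.m ≤ d'.i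
  · exact .inr (.inr (.inr (parallel d' d h₂)))
  by_cases h₃ : (d.i : ℕ) ≤ d'.i ∧ (d'.i : ℕ) + d'.m ≤ d.i + d.m
  · exact .inl (nested d d' h₃.1 h₃.2)
  by_cases h₄ : (d'.i : ℕ) ≤ d.i ∧ (d.i : ℕ) + d.m ≤ d'.i + d'.m
  · exact .inr (.inl (nested d' d h₄.1 h₄.2))
  exfalso
  by_cases h₅ : (d.i : ℕ) < d'.i
  · exact not_overlap d d' h₅ (by omega) (by omega)
  · exact not_overlap d' d (by omega) (by omega) (by omega)

end TMax

theorem mainTheorem2 :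
    (TMax.IsReduced ∧ NSOperad.IsFreeOn.{0, v} TMax TMax.indecomposables) ∧
    ∀ (k : Type u) [Field k],
      (TMax.linearize k).IsReduced ∧
      LinNSOperad.IsFreeOn.{u, u, w} (TMax.linearize k)
        (fun n => Submodule.span k
          ((fun T : TMax.Op n => Finsupp.single T (1 : k)) '' TMax.indecomposables n)) := by
  refine ⟨⟨TMax.isReduced, ?_⟩, fun k _ => ⟨NSOperad.isReduced_linearize TMax.isReduced k, ?_⟩⟩
  · exact NSOperad.isFreeOn_indecomposables TMax.isReduced TMax.hasCompatibleDecompositions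
  · exact LinNSOperad.isFreeOn_linearize
      (NSOperad.isFreeOn_indecomposables TMax.isReduced TMax.hasCompatibleDecompositions)
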